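/- Let $K$ be an algebraically closed field of characteristic $2$ (for instance $\overline{\mathbb F}_q$ with $q=2^m$), let $r\ge 3$ and $d=2^r-1$, and let $$P_{x^d}(x,y,z)=\frac{x^d+y^d+z^d+(x+y+z)^d}{(x+y)(x+z)(y+z)},$$ which is a homogeneous polynomial. In $\mathbb P^3(K)$ with coordinates $(x:y:z:t)$ let $S_1$ and $S_2$ be the cones with equations $P_{x^d}(x,y,z)=0$ and $P_{x^d}(x,y,t)=0$, and let $X=S_1\cap S_2$. Let $C\subset\mathbb P^2(K)$ be the plane curve with equation $P_{x^d}(x,y,z)=0$. Then $X$ has an irreducible component $C'$ (for the Zariski topology over the algebraically closed field $K$, that is, an absolutely irreducible component) which is defined over $\mathbb F_2$, is contained in the plane $x+z+t=0$, and is isomorphic to $C$, by an isomorphism defined over $\mathbb F_2$. Here the equation of $C$ is reduced: $P_{x^d}(x,y,z)$ generates the ideal of all polynomials that vanish on $C$. -/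

import Mathlib

open MvPolynomial

namespace DiffUniform

/-! ### The polynomial `P_f` -/

/-- In characteristic two, `(x+y)(x+z)(y+z)` divides `x^n + y^n + z^n + (x+y+z)^n`. -/
theorem pow_dvd {R : Type*} [CommRing R] [CharP R 2] (x y z : R) (n : ℕ) :
    (x + y) * (x + z) * (y + z) ∣ x ^ n + y ^ n + z ^ n + (x + y + z) ^ n := by
  have h2 : (2 : R) = 0 := CharTwo.two_eq_zero
  have key : ∀ n : ℕ, ∃ a b c : R, x ^ n + y ^ n = (x + y) * a ∧
      z ^ n + (x + y + z) ^ n = (x + y) * b ∧ a + b = (x + z) * (y + z) * c ∧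
      ∃ a' b' c' : R, x ^ (n + 1) + y ^ (n + 1) = (x + y) * a' ∧
      z ^ (n + 1) + (x + y + z) ^ (n + 1) = (x + y) * b' ∧
      a' + b' = (x + z) * (y + z) * c' := by
    intro n
    induction n with
    | zero =>
      exact ⟨0, 0, 0, by linear_combination h2, by linear_combination h2, by ring,
        1, 1, 0, by ring, by linear_combination z * h2, by linear_combination h2⟩
    | succ n ih =>
      obtain ⟨a, b, c, ha, hb, hc, a', b', c', ha', hb', hc'⟩ := ih
      refine ⟨a', b', c', ha', hb', hc', (x + y) * a' - x * y * a,
        (x + y) * b' - z * (x + y + z) * b, (x + y) * c' - x * y * c - b, ?_, ?_, ?_⟩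
      · linear_combination (x + y) * ha' - x * y * ha
      · linear_combination (x + y + 2 * z) * hb' - z * (x + y + z) * hb + (x + y) * z * b' * h2
      · linear_combination (x + y) * hc' - x * y * hc + x * y * b * h2
  obtain ⟨a, b, c, ha, hb, hc, -⟩ := key n
  exact ⟨c, by linear_combination ha + hb + (x + y) * hc⟩

section
variable {k : Type*} [Field k]

/-- The numerator `f(x) + f(y) + f(z) + f(x+y+z)`. -/
noncomputable def numer (f : Polynomial k) : MvPolynomial (Fin 3) k :=
  Polynomial.aeval (X 0) f + Polynomial.aeval (X 1) f + Polynomial.aeval (X 2) f +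
    Polynomial.aeval (X 0 + X 1 + X 2) f

/-- The denominator `(x+y)(x+z)(y+z)`. -/
noncomputable def denom (k : Type*) [Field k] : MvPolynomial (Fin 3) k :=
  (X 0 + X 1) * (X 0 + X 2) * (X 1 + X 2)

theorem denom_dvd_numer [CharP k 2] (f : Polynomial k) : denom k ∣ numer f := by
  induction f using Polynomial.induction_on' with
  | add p q hp hq =>
    have h := dvd_add hp hq
    have e : numer (p + q) = numer p + numer q := by
      simp only [numer, map_add]; ring
    rwa [e]
  | monomial n a =>
    have e : numer (Polynomial.monomial n a) =
        C a * (X 0 ^ n + X 1 ^ n + X 2 ^ n + (X 0 + X 1 + X 2) ^ n) := by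
      simp only [numer, Polynomial.aeval_monomial, MvPolynomial.algebraMap_eq]; ring
    rw [e]
    exact Dvd.dvd.mul_left (pow_dvd _ _ _ n) _

/-- `P_f(x,y,z)`, the quotient of `f(x) + f(y) + f(z) + f(x+y+z)` by `(x+y)(x+z)(y+z)`. -/
noncomputable def P [CharP k 2] (f : Polynomial k) : MvPolynomial (Fin 3) k :=
  (denom_dvd_numer f).choose

theorem denom_mul_P [CharP k 2] (f : Polynomial k) : denom k * P f = numer f :=
  (denom_dvd_numer f).choose_spec.symm

end

/-! ### Algebraic sets in projective space -/

/-- The projective space `ℙ(K^σ)` of lines in `K^σ`. -/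
abbrev PSpace (K : Type*) [Field K] (σ : Type*) : Type _ := Projectivization K (σ → K)

section
variable {K : Type*} [Field K] {σ τ : Type*}

/-- `F` (with coefficients in `k`) vanishes at all vectors of homogeneous coordinates of `p`. -/
def VanishesAt {k : Type*} [Field k] [Algebra k K] (F : MvPolynomial σ k) (p : PSpace K σ) :
    Prop :=
  ∀ (v : σ → K) (hv : v ≠ 0), Projectivization.mk K v hv = p → aeval v F = 0

/-- The locus `F = 0` in projective space. -/
def zeroLocus (F : MvPolynomial σ K) : Set (PSpace K σ) := {p | VanishesAt F p}

/-- The Zariski topology on projective space: generated by the complements of the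
hypersurfaces `F = 0`, with `F` homogeneous. -/
abbrev zariskiTopology (K : Type*) [Field K] (σ : Type*) : TopologicalSpace (PSpace K σ) :=
  TopologicalSpace.generateFrom
    {U | ∃ (n : ℕ) (F : MvPolynomial σ K), F.IsHomogeneous n ∧ U = (zeroLocus F)ᶜ}

/-- `Z` is an irreducible component of `Y`: a maximal irreducible subset of `Y` for the
Zariski topology. (Over an algebraically closed `K` it is absolutely irreducible.) -/
def IsComponent (Z Y : Set (PSpace K σ)) : Prop :=
  Maximal (fun W => W ⊆ Y ∧ @IsIrreducible _ (zariskiTopology K σ) W) Z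

/-- The ideal of all polynomials that vanish on `Y`. -/
def idealOf (Y : Set (PSpace K σ)) : Ideal (MvPolynomial σ K) where
  carrier := {F | ∀ p ∈ Y, VanishesAt F p}
  zero_mem' := fun _ _ _ _ _ => map_zero _
  add_mem' := fun {F G} hF hG p hp v hv h => by
    rw [map_add, hF p hp v hv h, hG p hp v hv h, add_zero]
  smul_mem' := fun c F hF p hp v hv h => by
    rw [smul_eq_mul, map_mul, hF p hp v hv h, mul_zero]

/-- `Y` is a closed set defined over the subfield `k`: its ideal is generated by polynomials
with coefficients in `k`. -/
def IsDefinedOver (k : Type*) [Field k] [Algebra k K] (Y : Set (PSpace K σ)) : Prop :=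
  @IsClosed _ (zariskiTopology K σ) Y ∧
    ∃ I : Ideal (MvPolynomial σ k), idealOf Y = I.map (MvPolynomial.map (algebraMap k K))

/-- `φ : Y → Z` is a regular map over `k`: near every point (on a principal open set given by a
homogeneous `G`) it is `q ↦ (F_j(q))_j`, with `F_j` homogeneous of one degree without common
zeros there; `G` and the `F_j` have coefficients in `k`. -/
def IsRegularMap (k : Type*) [Field k] [Algebra k K] {Y : Set (PSpace K σ)}
    {Z : Set (PSpace K τ)} (φ : Y → Z) : Prop :=
  ∀ p : Y, ∃ (c : ℕ) (G : MvPolynomial σ k) (e : ℕ) (F : τ → MvPolynomial σ k),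
    G.IsHomogeneous c ∧ ¬ VanishesAt G p.1 ∧ (∀ j, (F j).IsHomogeneous e) ∧
    ∀ q : Y, ¬ VanishesAt G q.1 →
      ∀ (v : σ → K) (hv : v ≠ 0), Projectivization.mk K v hv = q.1 →
        ∃ hw : (fun j => aeval v (F j)) ≠ (0 : τ → K),
          (φ q).1 = Projectivization.mk K (fun j => aeval v (F j)) hw

/-- `Y` and `Z` are isomorphic over `k`. -/
def IsomorphicOver (k : Type*) [Field k] [Algebra k K] (Y : Set (PSpace K σ))
    (Z : Set (PSpace K τ)) : Prop :=
  ∃ φ : Y ≃ Z, IsRegularMap k φ ∧ IsRegularMap k φ.symm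

end

/-! ### The curves; the coordinates `x, y, z, t` have the indices `0, 1, 2, 3`. -/

section
variable (K : Type*) [Field K] [CharP K 2] (d : ℕ)

/-- The cone `P_{x^d}(x,y,z) = 0` in `ℙ³`. -/
noncomputable def S₁ : Set (PSpace K (Fin 4)) :=
  zeroLocus (rename ![0, 1, 2] (P (Polynomial.X ^ d : Polynomial K)))

/-- The cone `P_{x^d}(x,y,t) = 0` in `ℙ³`. -/
noncomputable def S₂ : Set (PSpace K (Fin 4)) :=
  zeroLocus (rename ![0, 1, 3] (P (Polynomial.X ^ d : Polynomial K)))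

/-- The plane curve `P_{x^d}(x,y,z) = 0` in `ℙ²`. -/
noncomputable def planeCurve : Set (PSpace K (Fin 3)) :=
  zeroLocus (P (Polynomial.X ^ d : Polynomial K))

end

end DiffUniform

/-!
Write `q = 2 ^ r` and `D` for the polynomial `P_{x^d}` with `d = q - 1`. Multiplication of its
numerator by `x y z (x + y + z)` turns the powers `x ^ (q - 1)` into the additive powers `x ^ q`,
and the result is the Moore determinant `M_q` with rows `v`, `v²`, `v ^ q`, where `v = (x, y, z)`;
the product of the seven linear forms over `𝔽₂` is `M_4`. Hence `M_4 * D = M_q` (`moore_mul_P`), and `D`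
is invariant under linear substitutions over `𝔽₂`, in particular under `z ↦ x + z`
(`aeval_shear_P`). The two cones therefore cut the same curve out of the plane `x + z + t = 0`,
which is a copy of the plane curve `D = 0` and is the component looked for.

The main point is that `D` is irreducible (`irreducible_P`). A factorization `D = A B` has
homogeneous factors, and the curves `A = 0` and `B = 0` meet in a point `p` (`exists_common_zero`,
by Krull's height theorem and the Nullstellensatz). The expansion of `M_q` at `p` along arcs
`p + s v + s² u` excludes this (`no_common_zero`). As `M_q` is singular at `p`, the vector `p ^ q`
is a multiple `c p²` of `p²`, and
`M_q (p + s v) = c s² det (p, v², p²) + c s³ det (v, v², p²) + O(s⁴)`. If `M_4 (p) = 0`, the product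
`M_4 A B` vanishes to a higher order than this. Otherwise the quadratic term is the square of a
linear form with zero `v = √p`, at which the cubic term does not vanish: `p` is a cusp, through
which only one branch passes.

With `D` prime, the Nullstellensatz gives the ideal of the plane curve and of its copy in space, so
that the copy is irreducible and defined over `𝔽₂`. It is a maximal irreducible subset because, on
the intersection of the cones, `(x + z + t) Q = 0` for the cofactor `Q` of `x + z + t` in the
difference of the two equations. This `Q` restricts to `∂D/∂z` on the copy, which is not zero at a
suitable point (`not_planeSection_subset_cofactor`).
-/

namespace DiffUniform

/-! ### Moore determinants in characteristic two -/

section Det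
variable {R S : Type*} [CommRing R] [CommRing S]

/-- The determinant of the matrix with rows `a`, `b`, `c`. -/
def det3 (a b c : Fin 3 → R) : R :=
  a 0 * (b 1 * c 2 - b 2 * c 1) - a 1 * (b 0 * c 2 - b 2 * c 0) + a 2 * (b 0 * c 1 - b 1 * c 0)

/-- The Moore determinant with rows `v`, `v ^ 2`, `v ^ m` (coordinatewise powers). -/
def moore (m : ℕ) (v : Fin 3 → R) : R := det3 v (v ^ 2) (v ^ m)

theorem map_moore {F : Type*} [FunLike F R S] [RingHomClass F R S] (φ : F) (m : ℕ)
    (v : Fin 3 → R) : φ (moore m v) = moore m (fun i => φ (v i)) := by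
  simp [moore, det3]

variable [CharP R 2]

/-- Multiplied by `x y z (x + y + z)`, the powers with exponent `2 ^ r - 1` turn into the additive
powers with exponent `2 ^ r`. -/
theorem mul_pow_sum_eq_moore {r : ℕ} (x y z : R) :
    x * y * z * (x + y + z) *
      (x ^ (2 ^ r - 1) + y ^ (2 ^ r - 1) + z ^ (2 ^ r - 1) + (x + y + z) ^ (2 ^ r - 1)) =
      moore (2 ^ r) ![x, y, z] := by
  have h2 : (2 : R) = 0 := CharTwo.two_eq_zero
  have hp (a : R) : a * a ^ (2 ^ r - 1) = a ^ 2 ^ r := mul_pow_sub_one (by positivity) a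
  have hs : (x + y + z) ^ 2 ^ r = x ^ 2 ^ r + y ^ 2 ^ r + z ^ 2 ^ r := by
    rw [add_pow_char_pow, add_pow_char_pow]
  simp only [moore, det3, Pi.pow_apply, Matrix.cons_val]
  linear_combination y * z * (x + y + z) * hp x + x * z * (x + y + z) * hp y +
    x * y * (x + y + z) * hp z + x * y * z * (hp (x + y + z)) + x * y * z * hs +
    (x ^ 2 ^ r * (y * z * x + y ^ 2 * z ) +
      y ^ 2 ^ r * (y * z * x + x * z ^ 2) + z ^ 2 ^ r * (y * z * x + x ^ 2 * y)) * h2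

/-- `moore 4` is the product of the seven linear forms over `𝔽₂`. -/
theorem moore_four (x y z : R) :
    moore 4 ![x, y, z] = x * y * z * (x + y + z) * ((x + y) * (x + z) * (y + z)) := by
  have h2 : (2 : R) = 0 := CharTwo.two_eq_zero
  have h := mul_pow_sum_eq_moore (r := 2) x y z
  norm_num at h
  rw [← h]
  linear_combination x * y * z * (x + y + z) * (x ^ 3 + y ^ 3 + z ^ 3 + x ^ 2 * y + x ^ 2 * z +
    y ^ 2 * x + y ^ 2 * z + z ^ 2 * x + z ^ 2 * y + 2 * x * y * z) * h2

theorem moore_shear {r : ℕ} (x y z : R) :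
    moore (2 ^ r) ![x, y, x + z] = moore (2 ^ r) ![x, y, z] := by
  simp only [moore, det3, Pi.pow_apply, Matrix.cons_val, add_pow_char_pow]
  linear_combination (x * z * (y * x ^ 2 ^ r - x * y ^ 2 ^ r)) * CharTwo.two_eq_zero (R := R)

/-- The expansion of the Moore determinant along an arc `p + s v + s² u`, to third order in `s`. -/
theorem moore_arc {r : ℕ} (hr : 2 ≤ r) (p v u : Fin 3 → R) (s : R) : ∃ h : R,
    moore (2 ^ r) (fun i => p i + s * v i + s ^ 2 * u i) =
      det3 p (p ^ 2) (p ^ 2 ^ r) + s * det3 v (p ^ 2) (p ^ 2 ^ r) +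
      s ^ 2 * (det3 u (p ^ 2) (p ^ 2 ^ r) + det3 p (v ^ 2) (p ^ 2 ^ r)) +
      s ^ 3 * det3 v (v ^ 2) (p ^ 2 ^ r) + s ^ 4 * h := by
  obtain ⟨n, hn⟩ : ∃ n, 2 ^ r = 4 + n := Nat.exists_eq_add_of_le
    (by calc 4 = 2 ^ 2 := rfl
          _ ≤ 2 ^ r := Nat.pow_le_pow_right (by norm_num) hr)
  have hsq (i : Fin 3) : (p i + s * v i + s ^ 2 * u i) ^ 2 =
      p i ^ 2 + s ^ 2 * v i ^ 2 + s ^ 4 * u i ^ 2 := by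
    rw [CharTwo.add_sq, CharTwo.add_sq]; ring
  obtain ⟨k, hk⟩ : ∃ k : Fin 3 → R, ∀ i, (p i + s * v i + s ^ 2 * u i) ^ 2 ^ r =
      p i ^ 2 ^ r + s ^ 4 * k i := by
    refine ⟨fun i => s ^ n * v i ^ 2 ^ r + s ^ n * s ^ 2 ^ r * u i ^ 2 ^ r, fun i => ?_⟩
    rw [add_pow_char_pow, add_pow_char_pow, mul_pow, mul_pow, ← pow_mul, mul_comm 2, pow_mul]
    have : s ^ 2 ^ r = s ^ 4 * s ^ n := by rw [hn, pow_add]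
    generalize s ^ 2 ^ r = t at *
    rw [this]; ring
  refine ⟨det3 (fun i => p i + s * v i + s ^ 2 * u i)
    (fun i => p i ^ 2 + s ^ 2 * v i ^ 2 + s ^ 4 * u i ^ 2) k +
    det3 (fun i => p i + s * v i + s ^ 2 * u i) (u ^ 2) (p ^ 2 ^ r) +
    det3 u (v ^ 2) (p ^ 2 ^ r), ?_⟩
  simp only [moore, det3, Pi.pow_apply, hsq, hk]
  ring

end Det
/-! ### Homogeneous polynomials and intersections of plane curves -/

section Homogeneous
variable {σ K : Type*} [Field K]

/-- The substitution `X i ↦ X i * s`, whose coefficient of `s ^ n` is the homogeneous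
component of degree `n`. -/
noncomputable def scale (σ K : Type*) [Field K] :
    MvPolynomial σ K →ₐ[K] Polynomial (MvPolynomial σ K) :=
  aeval fun i => Polynomial.C (X i) * Polynomial.X

theorem scale_of_isHomogeneous {F : MvPolynomial σ K} {n : ℕ} (hF : F.IsHomogeneous n) :
    scale σ K F = Polynomial.monomial n F := by
  have key (d : σ →₀ ℕ) (a : K) :
      scale σ K (monomial d a) = Polynomial.monomial d.degree (monomial d a) := by
    rw [scale, aeval_monomial, ← Polynomial.C_mul_X_pow_eq_monomial,
      monomial_eq, Finsupp.prod, Finsupp.prod, Finsupp.degree_apply]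
    simp only [mul_pow, Finset.prod_mul_distrib, Finset.prod_pow_eq_pow_sum, map_mul, map_prod,
      map_pow, mul_assoc]
    rfl
  conv_lhs => rw [F.as_sum]
  conv_rhs => rw [F.as_sum]
  rw [map_sum, map_sum]
  refine Finset.sum_congr rfl fun d hd => ?_
  rw [key, ← hF (mem_support_iff.mp hd), Finsupp.degree_eq_weight_one]
  rfl

theorem coeff_scale (F : MvPolynomial σ K) (n : ℕ) :
    (scale σ K F).coeff n = homogeneousComponent n F := by
  conv_lhs => rw [← sum_homogeneousComponent F]
  rw [map_sum, Polynomial.finsetSum_coeff]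
  simp only [scale_of_isHomogeneous (homogeneousComponent_isHomogeneous _ F),
    Polynomial.coeff_monomial]
  simp only [Finset.sum_ite_eq', Finset.mem_range]
  split_ifs with h
  · rfl
  · exact (homogeneousComponent_eq_zero _ _ (by omega)).symm

theorem eval_one_scale (F : MvPolynomial σ K) : (scale σ K F).eval 1 = F := by
  induction F using MvPolynomial.induction_on with
  | C a => simp [scale, algebraMap_eq]
  | add p q hp hq => simp [hp, hq]
  | mul_X p i hp => simp [hp]; simp [scale]

/-- A factor of a nonzero homogeneous polynomial is homogeneous. -/
theorem exists_isHomogeneous_of_mul {F G : MvPolynomial σ K} {n : ℕ}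
    (h : (F * G).IsHomogeneous n) (h0 : F * G ≠ 0) :
    ∃ a b, a + b = n ∧ F.IsHomogeneous a ∧ G.IsHomogeneous b := by
  have inj (F : MvPolynomial σ K) (hF : F ≠ 0) : scale σ K F ≠ 0 := fun h => hF (by
    rw [← eval_one_scale F, h, Polynomial.eval_zero])
  have hF := inj F (left_ne_zero_of_mul h0)
  have hG := inj G (right_ne_zero_of_mul h0)
  have hm : scale σ K F * scale σ K G = Polynomial.monomial n (F * G) := by
    rw [← map_mul, scale_of_isHomogeneous h]
  have h1 := congrArg Polynomial.natDegree hm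
  have h2 := congrArg Polynomial.natTrailingDegree hm
  rw [Polynomial.natDegree_mul hF hG, Polynomial.natDegree_monomial_eq _ h0] at h1
  rw [Polynomial.natTrailingDegree_mul hF hG, Polynomial.natTrailingDegree_monomial h0] at h2
  have h3 := Polynomial.natTrailingDegree_le_natDegree (scale σ K F)
  have h4 := Polynomial.natTrailingDegree_le_natDegree (scale σ K G)
  have hom (F : MvPolynomial σ K)
      (hd : (scale σ K F).natTrailingDegree = (scale σ K F).natDegree) :
      F.IsHomogeneous (scale σ K F).natDegree := by
    have : F = homogeneousComponent (scale σ K F).natDegree F := by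
      conv_lhs => rw [← eval_one_scale F]
      rw [Polynomial.eval_eq_sum_range, Finset.sum_eq_single (scale σ K F).natDegree]
      · rw [coeff_scale, one_pow, mul_one]
      · intro i hi hne
        rw [Polynomial.coeff_eq_zero_of_lt_natTrailingDegree, zero_mul]
        have := Finset.mem_range.mp hi
        omega
      · simp
    conv_lhs => rw [this]
    exact homogeneousComponent_isHomogeneous _ F
  exact ⟨_, _, h1, hom F (by omega), hom G (by omega)⟩

theorem eval_zero_of_isHomogeneous_of_not_isUnit {F : MvPolynomial σ K} {n : ℕ}
    (hF : F.IsHomogeneous n) (hu : ¬ IsUnit F) : eval 0 F = 0 := by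
  rcases Nat.eq_zero_or_pos n with rfl | hn
  · have h := (totalDegree_eq_zero_iff_eq_C (p := F)).mp (Nat.le_zero.mp hF.totalDegree_le)
    by_contra h0
    apply hu
    rw [h] at h0 ⊢
    rw [eval_C] at h0
    exact (isUnit_iff_ne_zero.mpr h0).map C
  · rw [MvPolynomial.eval_zero, constantCoeff_eq]
    exact hF.coeff_eq_zero (by simpa using hn.ne)

/-- A homogeneous polynomial with coefficients in a subfield scales by `a ^ n`. -/
theorem aeval_smul_of_isHomogeneous {L : Type*} [Field L] [Algebra K L] {F : MvPolynomial σ K}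
    {n : ℕ} (hF : F.IsHomogeneous n) (a : L) (v : σ → L) :
    aeval (a • v) F = a ^ n * aeval v F := by
  have hcomp : (aeval (a • v) : MvPolynomial σ K →ₐ[K] L).toRingHom =
      (Polynomial.eval₂RingHom (aeval v : MvPolynomial σ K →ₐ[K] L).toRingHom a).comp
        (scale σ K).toRingHom := by
    apply MvPolynomial.ringHom_ext
    · intro c; simp [scale, algebraMap_eq]
    · intro i; simp [scale]; exact mul_comm _ _
  have h := RingHom.congr_fun hcomp F
  simp only [AlgHom.toRingHom_eq_coe, RingHom.coe_coe, RingHom.comp_apply,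
    scale_of_isHomogeneous hF, Polynomial.coe_eval₂RingHom, Polynomial.eval₂_monomial] at h
  rw [h, mul_comm]

end Homogeneous

section Intersection
variable {K : Type*} [Field K] [IsAlgClosed K]

/-- Two plane projective curves meet: two polynomials in three variables that vanish at the
origin have another common zero. -/
theorem exists_common_zero (A B : MvPolynomial (Fin 3) K)
    (hA : eval 0 A = 0) (hB : eval 0 B = 0) :
    ∃ p : Fin 3 → K, p ≠ 0 ∧ eval p A = 0 ∧ eval p B = 0 := by
  by_contra! hne
  let ev (v : Fin 3 → MvPolynomial (Fin 3) K) : MvPolynomial (Fin 3) K →+* MvPolynomial (Fin 3) K :=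
    (aeval v : MvPolynomial (Fin 3) K →ₐ[K] _).toRingHom
  have evX (v) (i) : ev v (X i) = v i := by simp [ev]
  -- A chain of four primes ending at the ideal of the origin shows that its height is at least 3.
  let q₁ := RingHom.ker (ev ![0, X 1, X 2])
  let q₂ := RingHom.ker (ev ![0, 0, X 2])
  let m := RingHom.ker (ev 0)
  have : q₁.IsPrime := RingHom.ker_isPrime _
  have : q₂.IsPrime := RingHom.ker_isPrime _
  have : m.IsPrime := RingHom.ker_isPrime _
  have ker_le (v w : Fin 3 → MvPolynomial (Fin 3) K) (h : ∀ i, ev w (v i) = w i) :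
      RingHom.ker (ev v) ≤ RingHom.ker (ev w) := by
    have : ev w = (ev w).comp (ev v) := by
      apply MvPolynomial.ringHom_ext
      · intro a; simp [ev]
      · intro i; simp only [RingHom.comp_apply, evX, h]
    intro F hF
    rw [RingHom.mem_ker] at hF ⊢
    rw [this, RingHom.comp_apply, hF, map_zero]
  have lt₁ : (⊥ : Ideal (MvPolynomial (Fin 3) K)) < q₁ := by
    refine bot_lt_iff_ne_bot.mpr fun h => ?_
    have : (X 0 : MvPolynomial (Fin 3) K) ∈ q₁ := by simp [q₁, RingHom.mem_ker, evX]
    rw [h] at this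
    exact X_ne_zero _ this
  have lt₂ : q₁ < q₂ := by
    refine lt_of_le_of_ne (ker_le _ _ ?_) fun h => ?_
    · intro i; fin_cases i <;> simp [evX]
    have : (X 1 : MvPolynomial (Fin 3) K) ∈ q₂ := by simp [q₂, RingHom.mem_ker, evX]
    rw [← h] at this
    simp [q₁, RingHom.mem_ker, evX] at this
  have lt₃ : q₂ < m := by
    refine lt_of_le_of_ne (ker_le _ _ ?_) fun h => ?_
    · intro i; fin_cases i <;> simp [evX]
    have : (X 2 : MvPolynomial (Fin 3) K) ∈ m := by simp [m, RingHom.mem_ker, evX]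
    rw [← h] at this
    simp [q₂, RingHom.mem_ker, evX] at this
  have hm (F : MvPolynomial (Fin 3) K) : F ∈ m ↔ eval 0 F = 0 := by
    have : ev 0 = (C : K →+* MvPolynomial (Fin 3) K).comp (eval 0) := by
      apply MvPolynomial.ringHom_ext
      · intro a; simp [ev, algebraMap_eq]
      · intro i; simp [evX]
    rw [RingHom.mem_ker, this, RingHom.comp_apply, C_eq_zero]
  -- By the Nullstellensatz that ideal is the radical of `(A, B)`.
  have hrad : (Ideal.span {A, B}).radical = m := by
    rw [← vanishingIdeal_zeroLocus_eq_radical (K := K)]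
    ext F
    rw [mem_vanishingIdeal_iff, hm]
    constructor
    · intro h
      have := h 0 (by
        rw [mem_zeroLocus_iff]
        intro G hG
        obtain ⟨a, b, rfl⟩ := Ideal.mem_span_pair.mp hG
        rw [aeval_eq_eval, map_add, map_mul, map_mul, hA, hB, mul_zero, mul_zero, add_zero])
      simpa [aeval_eq_eval] using this
    · intro h x hx
      rw [mem_zeroLocus_iff] at hx
      have h0 : x = 0 := by
        by_contra hx0
        have e1 := hx A (Ideal.subset_span (by simp))
        have e2 := hx B (Ideal.subset_span (by simp))
        simp only [aeval_eq_eval] at e1 e2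
        exact hne x hx0 e1 e2
      rw [h0]
      simpa [aeval_eq_eval] using h
  have hmin : m ∈ (Ideal.span {A, B}).minimalPrimes := by
    rw [← Ideal.radical_minimalPrimes, hrad, Ideal.minimalPrimes_eq_subsingleton_self]
    rfl
  have hcard : ({A, B} : Set (MvPolynomial (Fin 3) K)).ncard ≤ 2 :=
    (Set.ncard_insert_le A {B}).trans (by simp)
  have hle : m.height ≤ 2 :=
    (Ideal.height_le_card_of_mem_minimalPrimes_span (by simp) hmin).trans (by exact_mod_cast hcard)
  have s₁ := Order.add_one_le_of_lt (Ideal.height_strict_mono_of_isPrime_of_isPrime lt₁)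
  have s₂ := Order.add_one_le_of_lt (Ideal.height_strict_mono_of_isPrime_of_isPrime lt₂)
  have s₃ := Order.add_one_le_of_lt (Ideal.height_strict_mono_of_isPrime_of_isPrime lt₃)
  have h3 : (3 : ℕ∞) ≤ 2 := calc
    (3 : ℕ∞) = 0 + 1 + 1 + 1 := by norm_num
    _ ≤ Ideal.height ⊥ + 1 + 1 + 1 := by gcongr; exact zero_le
    _ ≤ q₁.height + 1 + 1 := by gcongr
    _ ≤ q₂.height + 1 := by gcongr
    _ ≤ m.height := s₃
    _ ≤ 2 := hle
  exact absurd h3 (by decide)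

end Intersection
/-! ### Local structure of the Moore curve -/

section Local
variable {K : Type*} [Field K]

/-- The second-order expansion of a polynomial along the arcs `p + s v + s² u`: the vector `u`
enters the coefficient of `s²` only through the differential at `p`. -/
theorem exists_arc_expansion (p : Fin 3 → K) (F : MvPolynomial (Fin 3) K) :
    ∃ (g : Fin 3 → K) (Q : (Fin 3 → K) → K), ∀ v u : Fin 3 → K, ∃ h : Polynomial K,
      aeval (fun i => Polynomial.C (p i) + Polynomial.X * Polynomial.C (v i) +
          Polynomial.X ^ 2 * Polynomial.C (u i)) F =
        Polynomial.C (eval p F) + Polynomial.X * Polynomial.C (g ⬝ᵥ v) +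
          Polynomial.X ^ 2 * Polynomial.C (Q v + g ⬝ᵥ u) + Polynomial.X ^ 3 * h := by
  induction F using MvPolynomial.induction_on with
  | C a => exact ⟨0, 0, fun v u => ⟨0, by simp [Polynomial.algebraMap_eq]⟩⟩
  | add F G hF hG =>
    obtain ⟨g, Q, hF⟩ := hF
    obtain ⟨g', Q', hG⟩ := hG
    refine ⟨g + g', Q + Q', fun v u => ?_⟩
    obtain ⟨h, hF⟩ := hF v u
    obtain ⟨h', hG⟩ := hG v u
    refine ⟨h + h', ?_⟩
    rw [map_add, hF, hG]
    simp only [add_dotProduct, Pi.add_apply, map_add]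
    ring
  | mul_X F i hF =>
    obtain ⟨g, Q, hF⟩ := hF
    refine ⟨p i • g + eval p F • Pi.single i 1, fun v => p i * Q v + (g ⬝ᵥ v) * v i,
      fun v u => ?_⟩
    obtain ⟨h, hF⟩ := hF v u
    refine ⟨h * (Polynomial.C (p i) + Polynomial.X * Polynomial.C (v i) +
        Polynomial.X ^ 2 * Polynomial.C (u i)) +
      Polynomial.C (Q v + g ⬝ᵥ u) * (Polynomial.C (v i) + Polynomial.X * Polynomial.C (u i)) +
      Polynomial.C (g ⬝ᵥ v) * Polynomial.C (u i), ?_⟩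
    rw [map_mul, hF, aeval_X]
    simp only [add_dotProduct, smul_dotProduct, single_dotProduct, smul_eq_mul, map_add, map_mul,
      eval_X, one_mul]
    ring

theorem coeff_ext_four {a₀ a₁ a₂ a₃ b₀ b₁ b₂ b₃ : K} {g h : Polynomial K}
    (e : Polynomial.C a₀ + Polynomial.X * Polynomial.C a₁ + Polynomial.X ^ 2 * Polynomial.C a₂ +
        Polynomial.X ^ 3 * Polynomial.C a₃ + Polynomial.X ^ 4 * g =
      Polynomial.C b₀ + Polynomial.X * Polynomial.C b₁ + Polynomial.X ^ 2 * Polynomial.C b₂ +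
        Polynomial.X ^ 3 * Polynomial.C b₃ + Polynomial.X ^ 4 * h) :
    a₁ = b₁ ∧ a₂ = b₂ ∧ a₃ = b₃ := by
  refine ⟨?_, ?_, ?_⟩
  · simpa [Polynomial.coeff_X, Polynomial.coeff_C, Polynomial.coeff_X_pow_mul'] using
      congrArg (fun f => Polynomial.coeff f 1) e
  · simpa [Polynomial.coeff_X, Polynomial.coeff_C, Polynomial.coeff_X_pow_mul'] using
      congrArg (fun f => Polynomial.coeff f 2) e
  · simpa [Polynomial.coeff_X, Polynomial.coeff_C, Polynomial.coeff_X_pow_mul'] using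
      congrArg (fun f => Polynomial.coeff f 3) e

theorem det3_C (x y z : Fin 3 → K) (m n : ℕ) :
    det3 (fun i => Polynomial.C (x i)) ((fun i => Polynomial.C (y i)) ^ m)
      ((fun i => Polynomial.C (z i)) ^ n) = Polynomial.C (det3 x (y ^ m) (z ^ n)) := by
  simp [det3]

theorem dotProduct_surjective {g : Fin 3 → K} (hg : g ≠ 0) (c : K) : ∃ u, g ⬝ᵥ u = c := by
  obtain ⟨i, hi⟩ := Function.ne_iff.mp hg
  refine ⟨Pi.single i (c / g i), ?_⟩
  rw [dotProduct_single, mul_div_cancel₀ _ hi]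

/-- If `det (a, b, v²) = 0` for all `v`, the vectors `a` and `b` are proportional. -/
theorem cross_eq_zero_of_det3_sq {a b : Fin 3 → K} (h : ∀ v : Fin 3 → K, det3 a (v ^ 2) b = 0) :
    a 1 * b 2 = a 2 * b 1 ∧ a 0 * b 2 = a 2 * b 0 ∧ a 0 * b 1 = a 1 * b 0 := by
  have h0 := h ![1, 0, 0]
  have h1 := h ![0, 1, 0]
  have h2 := h ![0, 0, 1]
  simp [det3] at h0 h1 h2
  exact ⟨by linear_combination -h0, by linear_combination h1, by linear_combination -h2⟩

theorem cross_eq_zero_of_det3 {a b : Fin 3 → K} (h : ∀ v : Fin 3 → K, det3 v a b = 0) :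
    a 1 * b 2 = a 2 * b 1 ∧ a 0 * b 2 = a 2 * b 0 ∧ a 0 * b 1 = a 1 * b 0 := by
  have h0 := h ![1, 0, 0]
  have h1 := h ![0, 1, 0]
  have h2 := h ![0, 0, 1]
  simp [det3] at h0 h1 h2
  exact ⟨by linear_combination h0, by linear_combination -h1, by linear_combination h2⟩

theorem exists_smul_of_cross_eq_zero {a b : Fin 3 → K} (ha : a ≠ 0)
    (h : a 1 * b 2 = a 2 * b 1 ∧ a 0 * b 2 = a 2 * b 0 ∧ a 0 * b 1 = a 1 * b 0) :
    ∃ c : K, b = c • a := by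
  obtain ⟨h0, h1, h2⟩ := h
  obtain ⟨i, hi⟩ := Function.ne_iff.mp ha
  refine ⟨b i / a i, funext fun j => ?_⟩
  rw [Pi.smul_apply, smul_eq_mul, div_mul_eq_mul_div, eq_div_iff hi]
  fin_cases i <;> fin_cases j <;> simp only [Fin.zero_eta, Fin.mk_one, Fin.reduceFinMk] <;>
    first | rfl | linear_combination h0 | linear_combination -h0 | linear_combination h1 |
      linear_combination -h1 | linear_combination h2 | linear_combination -h2

/-- A vector `a` such that `det (v, v², a) = 0` for all `v` is zero. -/
theorem eq_zero_of_det3_sq [Infinite K] {a : Fin 3 → K}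
    (h : ∀ v : Fin 3 → K, det3 v (v ^ 2) a = 0) : a = 0 := by
  classical
  obtain ⟨t, ht⟩ := Infinite.exists_notMem_finset ({0, 1} : Finset K)
  simp only [Finset.mem_insert, Finset.mem_singleton, not_or] at ht
  have ht' : t ^ 2 - t ≠ 0 := by
    rw [sq, ← mul_sub_one]
    exact mul_ne_zero ht.1 (sub_ne_zero.mpr ht.2)
  have h0 := h ![0, 1, t]
  have h1 := h ![1, 0, t]
  have h2 := h ![1, t, 0]
  simp [det3] at h0 h1 h2
  funext i
  refine (mul_eq_zero.mp (?_ : (t ^ 2 - t) * a i = 0)).resolve_left ht'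
  fin_cases i <;> simp only [Fin.zero_eta, Fin.mk_one, Fin.reduceFinMk]
  · linear_combination h0
  · linear_combination -h1
  · linear_combination h2

variable [IsAlgClosed K] [CharP K 2]

/-- Locally at every point, the Moore curve minus the lines over `𝔽₂` has only one branch:
two factors of its equation have no common zero. At a singular point `p` the vector `p ^ q` is a
multiple of `p²`. If `p` is on no line over `𝔽₂`, it is a cusp with tangent direction `√p`; if `p`
is on such a line, already the order of the Moore determinant at `p` is too small. -/
theorem no_common_zero {r : ℕ} (hr : 2 ≤ r) {A B : MvPolynomial (Fin 3) K}
    (hAB : moore (2 ^ 2) X * (A * B) = moore (2 ^ r) X) {p : Fin 3 → K} (hp : p ≠ 0)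
    (hA : eval p A = 0) (hB : eval p B = 0) : False := by
  obtain ⟨a, QA, expA⟩ := exists_arc_expansion p A
  obtain ⟨b, QB, expB⟩ := exists_arc_expansion p B
  set m₀ := det3 p (p ^ 2) (p ^ 2 ^ 2) with hm₀
  -- Comparison of the coefficients of `s`, `s²` and `s³` along the arc `p + s v + s² u`.
  have main (v u : Fin 3 → K) :
      0 = det3 v (p ^ 2) (p ^ 2 ^ r) ∧
      m₀ * ((a ⬝ᵥ v) * (b ⬝ᵥ v)) = det3 u (p ^ 2) (p ^ 2 ^ r) + det3 p (v ^ 2) (p ^ 2 ^ r) ∧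
      m₀ * ((a ⬝ᵥ v) * (QB v + b ⬝ᵥ u) + (b ⬝ᵥ v) * (QA v + a ⬝ᵥ u)) +
        det3 v (p ^ 2) (p ^ 2 ^ 2) * ((a ⬝ᵥ v) * (b ⬝ᵥ v)) = det3 v (v ^ 2) (p ^ 2 ^ r) := by
    obtain ⟨hA', eA⟩ := expA v u
    obtain ⟨hB', eB⟩ := expB v u
    rw [hA, map_zero, zero_add] at eA
    rw [hB, map_zero, zero_add] at eB
    have e := congrArg (aeval (fun i => Polynomial.C (p i) + Polynomial.X * Polynomial.C (v i) +
          Polynomial.X ^ 2 * Polynomial.C (u i))) hAB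
    rw [map_mul, map_mul, map_moore, map_moore, eA, eB] at e
    simp only [aeval_X] at e
    obtain ⟨h4, e4⟩ := moore_arc le_rfl (fun i => Polynomial.C (p i)) (fun i => Polynomial.C (v i))
      (fun i => Polynomial.C (u i)) (Polynomial.X : Polynomial K)
    obtain ⟨hr, er⟩ := moore_arc hr (fun i => Polynomial.C (p i)) (fun i => Polynomial.C (v i))
      (fun i => Polynomial.C (u i)) (Polynomial.X : Polynomial K)
    rw [e4, er] at e
    simp only [det3_C, ← hm₀] at e
    set α := a ⬝ᵥ v
    set γ := b ⬝ᵥ v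
    set β := QA v + a ⬝ᵥ u
    set δ := QB v + b ⬝ᵥ u
    set m₁ := det3 v (p ^ 2) (p ^ 2 ^ 2)
    -- `N` is the remainder of `M₄` after its terms in `1` and `s`; `L` and `R` are the coefficient
    -- of `s³` and the remainder after it in the product of the two factors.
    set N := Polynomial.C (det3 u (p ^ 2) (p ^ 2 ^ 2)) + Polynomial.C (det3 p (v ^ 2) (p ^ 2 ^ 2)) +
      Polynomial.X * Polynomial.C (det3 v (v ^ 2) (p ^ 2 ^ 2)) + Polynomial.X ^ 2 * h4
    set R := Polynomial.C α * hB' + Polynomial.C β * Polynomial.C δ + Polynomial.C γ * hA' +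
      Polynomial.X * (Polynomial.C β * hB' + Polynomial.C δ * hA') + Polynomial.X ^ 2 * hA' * hB'
    set L := Polynomial.C α * Polynomial.C δ + Polynomial.C γ * Polynomial.C β
    refine coeff_ext_four (a₀ := 0) (b₀ := det3 p (p ^ 2) (p ^ 2 ^ r))
      (g := Polynomial.C m₀ * R + Polynomial.C m₁ * L +
      Polynomial.C m₁ * Polynomial.X * R + N * (Polynomial.C α * Polynomial.C γ + Polynomial.X * L +
      Polynomial.X ^ 2 * R)) (h := hr) ?_
    simp only [map_add, map_mul, map_zero]
    rw [← e]
    ring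
  obtain ⟨c, hc⟩ := exists_smul_of_cross_eq_zero (pow_ne_zero 2 hp)
    (cross_eq_zero_of_det3 fun v => (main v 0).1.symm)
  have hpq : p ^ 2 ^ r ≠ 0 := pow_ne_zero _ hp
  have hc0 : c ≠ 0 := by
    rintro rfl
    exact hpq (by rw [hc, zero_smul])
  have h2 (v : Fin 3 → K) : m₀ * ((a ⬝ᵥ v) * (b ⬝ᵥ v)) = det3 p (v ^ 2) (p ^ 2 ^ r) := by
    rw [(main v 0).2.1]
    simp [det3]
  -- If the quadratic term is zero, `p` is a multiple of a point over `𝔽₂`. There `M₄` vanishes with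
  -- its first derivatives, and the cubic term of the other side is not zero.
  have hcusp : ¬ ∀ v, det3 p (v ^ 2) (p ^ 2 ^ r) = 0 := by
    intro h
    obtain ⟨k0, k1, k2⟩ := cross_eq_zero_of_det3_sq h
    rw [hc] at k0 k1 k2
    simp only [Pi.smul_apply, Pi.pow_apply, smul_eq_mul] at k0 k1 k2
    have l0 : p 1 * p 2 ^ 2 = p 2 * p 1 ^ 2 := mul_left_cancel₀ hc0 (by linear_combination k0)
    have l1 : p 0 * p 2 ^ 2 = p 2 * p 0 ^ 2 := mul_left_cancel₀ hc0 (by linear_combination k1)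
    have l2 : p 0 * p 1 ^ 2 = p 1 * p 0 ^ 2 := mul_left_cancel₀ hc0 (by linear_combination k2)
    have hm : m₀ = 0 := by
      simp only [hm₀, det3, Pi.pow_apply]
      linear_combination p 0 ^ 4 * l0 - p 1 ^ 4 * l1 + p 2 ^ 4 * l2
    refine hpq (eq_zero_of_det3_sq fun v => ?_)
    have hm1 : det3 v (p ^ 2) (p ^ 2 ^ 2) = 0 := by
      simp only [det3, Pi.pow_apply]
      linear_combination v 0 * (p 1 * p 2 ^ 2 + p 2 * p 1 ^ 2) * l0 -
        v 1 * (p 0 * p 2 ^ 2 + p 2 * p 0 ^ 2) * l1 + v 2 * (p 0 * p 1 ^ 2 + p 1 * p 0 ^ 2) * l2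
    rw [← (main v 0).2.2, hm, hm1, zero_mul, zero_mul, add_zero]
  have hm : m₀ ≠ 0 := fun h => hcusp fun v => by rw [← h2, h, zero_mul]
  -- `p` is a cusp, with tangent direction `w = √p`.
  choose w hw using fun i => IsAlgClosed.exists_pow_nat_eq (p i) (n := 2) (by norm_num)
  have hw : w ^ 2 = p := funext hw
  have hD : det3 w p (p ^ 2) ≠ 0 := by
    intro h
    apply hm
    have : m₀ = frobenius K 2 (det3 w p (p ^ 2)) := by
      rw [hm₀, ← hw]
      simp only [det3, Pi.pow_apply, map_add, map_sub, map_mul, map_pow, frobenius_def]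
      ring
    rw [this, h, map_zero]
  have h5 : (a ⬝ᵥ w) * (b ⬝ᵥ w) = 0 := by
    refine (mul_eq_zero.mp ((h2 w).trans ?_)).resolve_left hm
    rw [hw, det3]
    ring
  have h3 (u : Fin 3 → K) :
      (a ⬝ᵥ w) * (QB w + b ⬝ᵥ u) + (b ⬝ᵥ w) * (QA w + a ⬝ᵥ u) ≠ 0 := by
    intro h
    have h4 := (main w u).2.2
    rw [h, h5, mul_zero, mul_zero, add_zero, hw, hc] at h4
    refine mul_ne_zero hc0 hD (Eq.trans ?_ h4.symm)
    simp [det3]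
    ring
  -- One factor vanishes to second order along the tangent direction, so the vector `u` can be
  -- chosen to raise the order of the product, unless its differential is zero.
  have key {a b : Fin 3 → K} {QA QB : (Fin 3 → K) → K} (hb : b ⬝ᵥ w = 0)
      (h2 : ∀ v, m₀ * ((a ⬝ᵥ v) * (b ⬝ᵥ v)) = det3 p (v ^ 2) (p ^ 2 ^ r))
      (h3 : ∀ u, (a ⬝ᵥ w) * (QB w + b ⬝ᵥ u) + (b ⬝ᵥ w) * (QA w + a ⬝ᵥ u) ≠ 0) : False := by
    have hb0 : b ≠ 0 := by
      rintro rfl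
      exact hcusp fun v => by rw [← h2, zero_dotProduct, mul_zero, mul_zero]
    obtain ⟨u, hu⟩ := dotProduct_surjective hb0 (-QB w)
    exact h3 u (by rw [hu, hb]; ring)
  rcases mul_eq_zero.mp h5 with h | h
  · exact key h (fun v => by rw [← h2, mul_comm (b ⬝ᵥ v)]) fun u => by rw [add_comm]; exact h3 u
  · exact key h h2 h3

end Local
/-! ### Irreducibility of the polynomial of the curve -/

section Curve
variable {k : Type*} [Field k]

theorem X_eq_vec : (X : Fin 3 → MvPolynomial (Fin 3) k) = ![X 0, X 1, X 2] := by
  funext i; fin_cases i <;> rfl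

theorem moore_X_isHomogeneous (m : ℕ) :
    (moore m X : MvPolynomial (Fin 3) k).IsHomogeneous (1 + (2 + m)) := by
  have hX := isHomogeneous_X k (σ := Fin 3)
  have hp (i : Fin 3) (n : ℕ) : (X i ^ n : MvPolynomial (Fin 3) k).IsHomogeneous n := by
    simpa using (hX i).pow n
  have hm (i j l : Fin 3) : (X i * (X j ^ 2 * X l ^ m - X l ^ 2 * X j ^ m) :
      MvPolynomial (Fin 3) k).IsHomogeneous (1 + (2 + m)) :=
    (hX i).mul (((hp j 2).mul (hp l m)).sub ((hp l 2).mul (hp j m)))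
  exact ((hm 0 1 2).sub (hm 1 0 2)).add (hm 2 0 1)

theorem natDegree_moore_line {m : ℕ} (hm : 2 < m) {α : k} (hα : α ^ 2 ≠ α) :
    (moore m ![1, Polynomial.C α, Polynomial.X]).natDegree = m := by
  have h : moore m ![1, Polynomial.C α, Polynomial.X] =
      Polynomial.C (α ^ 2 - α) * Polynomial.X ^ m + (Polynomial.C (α - α ^ m) * Polynomial.X ^ 2 +
      Polynomial.C (α ^ m - α ^ 2) * Polynomial.X) := by
    simp only [moore, det3, Pi.pow_apply, Matrix.cons_val, map_sub, map_pow, one_pow]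
    ring
  rw [h, Polynomial.natDegree_add_eq_left_of_natDegree_lt,
    Polynomial.natDegree_C_mul_X_pow _ _ (sub_ne_zero.mpr hα)]
  rw [Polynomial.natDegree_C_mul_X_pow _ _ (sub_ne_zero.mpr hα)]
  refine lt_of_le_of_lt ?_ hm
  compute_degree

theorem moore_X_ne_zero [Infinite k] {m : ℕ} (hm : 2 < m) :
    (moore m X : MvPolynomial (Fin 3) k) ≠ 0 := by
  classical
  obtain ⟨t, ht⟩ := Infinite.exists_notMem_finset ({0, 1} : Finset k)
  simp only [Finset.mem_insert, Finset.mem_singleton, not_or] at ht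
  have ht' : t ^ 2 ≠ t := fun h => ht.2 (mul_left_cancel₀ ht.1 (by rw [← sq, h, mul_one]))
  intro h
  have h1 := congrArg (aeval ![1, Polynomial.C t, Polynomial.X]) h
  rw [map_moore, map_zero] at h1
  simp only [aeval_X] at h1
  have h2 := natDegree_moore_line hm ht'
  have h3 : moore m ![1, Polynomial.C t, Polynomial.X] = 0 := h1
  rw [h3, Polynomial.natDegree_zero] at h2
  omega

theorem eight_le_two_pow {r : ℕ} (hr : 3 ≤ r) : 8 ≤ 2 ^ r :=
  Nat.pow_le_pow_right (n := 2) (by norm_num) hr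

variable [CharP k 2]

/-- The polynomial of the curve is a quotient of two Moore determinants. -/
theorem moore_mul_P (r : ℕ) :
    moore (2 ^ 2) X * P (Polynomial.X ^ (2 ^ r - 1) : Polynomial k) = moore (2 ^ r) X := by
  have h := denom_mul_P (Polynomial.X ^ (2 ^ r - 1) : Polynomial k)
  rw [numer, denom] at h
  simp only [map_pow, Polynomial.aeval_X] at h
  rw [show 2 ^ 2 = 4 from rfl, X_eq_vec, moore_four, ← mul_pow_sum_eq_moore, ← h]
  ring

theorem P_ne_zero [Infinite k] {r : ℕ} (hr : 3 ≤ r) :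
    P (Polynomial.X ^ (2 ^ r - 1) : Polynomial k) ≠ 0 := by
  have := eight_le_two_pow hr
  intro h
  have h1 := moore_mul_P (k := k) r
  rw [h, mul_zero] at h1
  exact moore_X_ne_zero (by omega) h1.symm

theorem P_isHomogeneous [Infinite k] {r : ℕ} (hr : 3 ≤ r) :
    (P (Polynomial.X ^ (2 ^ r - 1) : Polynomial k)).IsHomogeneous (2 ^ r - 4) := by
  have := eight_le_two_pow hr
  have h0 := moore_X_ne_zero (k := k) (m := 2 ^ r) (by omega)
  rw [← moore_mul_P] at h0
  have h := moore_X_isHomogeneous (k := k) (2 ^ r)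
  rw [← moore_mul_P] at h
  obtain ⟨a, b, hab, ha, hb⟩ := exists_isHomogeneous_of_mul h h0
  have := ha.inj_right (moore_X_isHomogeneous (2 ^ 2)) (left_ne_zero_of_mul h0)
  convert! hb using 1
  omega

/-- The polynomial of the curve is invariant under the shear `z ↦ x + z`. -/
theorem aeval_shear_P [Infinite k] (r : ℕ) :
    aeval ![X 0, X 1, X 0 + X 2] (P (Polynomial.X ^ (2 ^ r - 1) : Polynomial k)) =
      P (Polynomial.X ^ (2 ^ r - 1) : Polynomial k) := by
  refine mul_left_cancel₀ (moore_X_ne_zero (k := k) (m := 2 ^ 2) (by norm_num)) ?_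
  have hs (r : ℕ) : aeval (![X 0, X 1, X 0 + X 2] : Fin 3 → MvPolynomial (Fin 3) k)
      (moore (2 ^ r) X : MvPolynomial (Fin 3) k) =
      moore (2 ^ r) X := by
    rw [map_moore]
    simp only [aeval_X]
    conv_rhs => rw [X_eq_vec, ← moore_shear]
  conv_lhs => rw [← hs 2, ← map_mul, moore_mul_P, hs]
  rw [moore_mul_P]

variable [IsAlgClosed k]

/-- Factors of the polynomial of the curve are homogeneous, so their zero loci would meet; but they
have no common zero. -/
theorem irreducible_P {r : ℕ} (hr : 3 ≤ r) :
    Irreducible (P (Polynomial.X ^ (2 ^ r - 1) : Polynomial k)) := by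
  have h8 := eight_le_two_pow hr
  have hP := P_isHomogeneous (k := k) hr
  have hP0 := P_ne_zero (k := k) hr
  constructor
  · intro hu
    have : eval 0 (P (Polynomial.X ^ (2 ^ r - 1) : Polynomial k)) = 0 := by
      rw [MvPolynomial.eval_zero, constantCoeff_eq]
      refine hP.coeff_eq_zero ?_
      simp
      omega
    have hu := hu.map (eval (0 : Fin 3 → k))
    rw [this] at hu
    exact not_isUnit_zero hu
  · intro A B hAB
    by_contra! hu
    rw [hAB] at hP hP0
    obtain ⟨a, b, -, ha, hb⟩ := exists_isHomogeneous_of_mul hP hP0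
    obtain ⟨p, hp, hA, hB⟩ := exists_common_zero A B
      (eval_zero_of_isHomogeneous_of_not_isUnit ha hu.1)
      (eval_zero_of_isHomogeneous_of_not_isUnit hb hu.2)
    exact no_common_zero (by omega) (hAB ▸ moore_mul_P r) hp hA hB

/-- A point of the curve at which the derivative of the Moore determinant by the third coordinate
is not zero. -/
theorem exists_point {r : ℕ} (hr : 3 ≤ r) : ∃ x y z : k,
    eval ![x, y, z] (P (Polynomial.X ^ (2 ^ r - 1) : Polynomial k)) = 0 ∧
      x ^ 2 * y ^ 2 ^ r - y ^ 2 * x ^ 2 ^ r ≠ 0 := by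
  have h8 := eight_le_two_pow hr
  have hne : (Polynomial.X ^ 2 ^ r - Polynomial.X ^ 2 : Polynomial k) ≠ 0 := by
    intro h
    have := congrArg (fun f => Polynomial.coeff f 2) h
    rw [Polynomial.coeff_sub, Polynomial.coeff_X_pow_self, Polynomial.coeff_X_pow,
      if_neg (by omega)] at this
    simp at this
  obtain ⟨α, hα⟩ : ∃ α : k, α ^ 2 ^ r - α ^ 2 ≠ 0 := by
    by_contra! h
    exact hne (Polynomial.funext fun a => by simpa using h a)
  have hα2 : α ^ 2 ≠ α := by
    intro h
    apply hα
    have : ∀ n, α ^ (n + 1) = α := by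
      intro n
      induction n with
      | zero => simp
      | succ n ih => rw [pow_succ, ih, ← sq, h]
    obtain ⟨n, hn⟩ : ∃ n, 2 ^ r = n + 1 := ⟨2 ^ r - 1, by omega⟩
    rw [hn, this, h, sub_self]
  set p := aeval ![1, Polynomial.C α, Polynomial.X]
    (P (Polynomial.X ^ (2 ^ r - 1) : Polynomial k)) with hp
  have hmul : moore (2 ^ 2) ![1, Polynomial.C α, Polynomial.X] * p =
      moore (2 ^ r) ![1, Polynomial.C α, Polynomial.X] := by
    have := congrArg (aeval ![1, Polynomial.C α, Polynomial.X]) (moore_mul_P (k := k) r)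
    rw [map_mul, map_moore, map_moore] at this
    simpa only [aeval_X] using this
  have hdeg : p.degree ≠ 0 := by
    intro h
    have h1 := congrArg Polynomial.natDegree hmul
    rw [natDegree_moore_line (by omega) hα2, Polynomial.eq_C_of_degree_eq_zero h] at h1
    have h2 := Polynomial.natDegree_mul_C_le (moore (2 ^ 2) ![1, Polynomial.C α, Polynomial.X])
      (p.coeff 0)
    rw [natDegree_moore_line (by omega) hα2] at h2
    omega
  obtain ⟨z, hz⟩ := IsAlgClosed.exists_root p hdeg
  refine ⟨1, α, z, ?_, by simpa using hα⟩
  have hcomp : (eval ![1, α, z] : MvPolynomial (Fin 3) k →+* k) =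
      (Polynomial.evalRingHom z).comp
        (aeval ![1, Polynomial.C α, Polynomial.X] : MvPolynomial (Fin 3) k →ₐ[k] _).toRingHom := by
    apply MvPolynomial.ringHom_ext
    · intro a; simp [Polynomial.algebraMap_eq]
    · intro i; fin_cases i <;> simp
  rw [hcomp]
  exact hz

end Curve
/-! ### The Zariski topology and the ideal of the plane curve -/

section Zariski
variable {K : Type*} [Field K] {σ : Type*}

theorem vanishesAt_mk {k : Type*} [Field k] [Algebra k K] {F : MvPolynomial σ k} {n : ℕ}
    (hF : F.IsHomogeneous n) {v : σ → K} (hv : v ≠ 0) :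
    VanishesAt F (Projectivization.mk K v hv) ↔ aeval v F = 0 := by
  refine ⟨fun h => h v hv rfl, fun h w hw hwv => ?_⟩
  obtain ⟨a, rfl⟩ := (Projectivization.mk_eq_mk_iff K w v hw hv).mp hwv
  have := aeval_smul_of_isHomogeneous hF (a : K) v
  rw [h, mul_zero] at this
  exact this

theorem mk_mem_zeroLocus {F : MvPolynomial σ K} {n : ℕ}
    (hF : F.IsHomogeneous n) {v : σ → K} (hv : v ≠ 0) :
    Projectivization.mk K v hv ∈ zeroLocus F ↔ eval v F = 0 := by
  rw [← aeval_eq_eval]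
  exact vanishesAt_mk hF hv

theorem zeroLocus_mul {F G : MvPolynomial σ K} {m n : ℕ} (hF : F.IsHomogeneous m)
    (hG : G.IsHomogeneous n) : zeroLocus (F * G) = zeroLocus F ∪ zeroLocus G := by
  ext p
  induction p using Projectivization.ind with
  | h v hv =>
    rw [Set.mem_union, mk_mem_zeroLocus (hF.mul hG), mk_mem_zeroLocus hF, mk_mem_zeroLocus hG,
      map_mul, mul_eq_zero]

theorem isClosed_zeroLocus {F : MvPolynomial σ K} {n : ℕ} (hF : F.IsHomogeneous n) :
    @IsClosed _ (zariskiTopology K σ) (zeroLocus F) := by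
  let := zariskiTopology K σ
  exact ⟨TopologicalSpace.isOpen_generateFrom_of_mem ⟨n, F, hF, rfl⟩⟩

/-- The generating sets of the Zariski topology are closed under intersection. -/
theorem isTopologicalBasis_zariski :
    @TopologicalSpace.IsTopologicalBasis _ (zariskiTopology K σ)
      {U | ∃ (n : ℕ) (F : MvPolynomial σ K), F.IsHomogeneous n ∧ U = (zeroLocus F)ᶜ} := by
  let := zariskiTopology K σ
  refine ⟨?_, ?_, rfl⟩
  · rintro _ ⟨m, F, hF, rfl⟩ _ ⟨n, G, hG, rfl⟩ p hp
    refine ⟨_, ⟨m + n, F * G, hF.mul hG, rfl⟩, ?_, ?_⟩ <;>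
      rw [zeroLocus_mul hF hG, Set.compl_union]
    exact hp
  · refine Set.eq_univ_of_forall fun p => ?_
    refine Set.mem_sUnion.mpr ⟨_, ⟨0, 1, isHomogeneous_one _ _, rfl⟩, fun h => ?_⟩
    induction p using Projectivization.ind with
    | h v hv =>
      rw [mk_mem_zeroLocus (isHomogeneous_one _ _), map_one] at h
      exact one_ne_zero h

/-- A nonempty set with prime ideal is irreducible. -/
theorem isIrreducible_of_idealOf {Y : Set (PSpace K σ)} (hY : Y.Nonempty)
    (h : ∀ F G, F * G ∈ idealOf Y → F ∈ idealOf Y ∨ G ∈ idealOf Y) :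
    @IsIrreducible _ (zariskiTopology K σ) Y := by
  let := zariskiTopology K σ
  refine ⟨hY, fun U V hU hV ⟨p, hpY, hpU⟩ ⟨q, hqY, hqV⟩ => ?_⟩
  obtain ⟨_, ⟨m, F, hF, rfl⟩, hpF, hFU⟩ :=
    isTopologicalBasis_zariski.exists_subset_of_mem_open hpU hU
  obtain ⟨_, ⟨n, G, hG, rfl⟩, hqG, hGV⟩ :=
    isTopologicalBasis_zariski.exists_subset_of_mem_open hqV hV
  by_contra hne
  have hFG : F * G ∈ idealOf Y := by
    intro y hy
    change y ∈ zeroLocus (F * G)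
    rw [zeroLocus_mul hF hG]
    by_contra hy'
    rw [Set.mem_union, not_or] at hy'
    exact hne ⟨y, hy, hFU hy'.1, hGV hy'.2⟩
  rcases h F G hFG with h | h
  · exact hpF (h p hpY)
  · exact hqG (h q hqY)

end Zariski

section PlaneCurve
variable {K : Type*} [Field K] [IsAlgClosed K] [CharP K 2] {r : ℕ}

theorem mk_mem_planeCurve (hr : 3 ≤ r) {v : Fin 3 → K} (hv : v ≠ 0) :
    Projectivization.mk K v hv ∈ planeCurve K (2 ^ r - 1) ↔
      eval v (P (Polynomial.X ^ (2 ^ r - 1) : Polynomial K)) = 0 :=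
  mk_mem_zeroLocus (P_isHomogeneous hr) hv

/-- By the Nullstellensatz and the irreducibility of its equation, the ideal of the plane curve is
generated by that equation. The origin of `K³`, which represents no projective point, is taken care
of by multiplication with a coordinate. -/
theorem idealOf_planeCurve (hr : 3 ≤ r) : idealOf (planeCurve K (2 ^ r - 1)) =
    Ideal.span {P (Polynomial.X ^ (2 ^ r - 1) : Polynomial K)} := by
  set D := P (Polynomial.X ^ (2 ^ r - 1) : Polynomial K) with hD
  have hprime : Prime D := (irreducible_P hr).prime
  have : (Ideal.span {D}).IsPrime := (Ideal.span_singleton_prime hprime.ne_zero).mpr hprime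
  apply le_antisymm
  · intro F hF
    have hX (i : Fin 3) : X i * F ∈ Ideal.span {D} := by
      rw [← IsPrime.vanishingIdeal_zeroLocus (K := K) (Ideal.span {D}), mem_vanishingIdeal_iff]
      intro v hv
      rw [mem_zeroLocus_iff] at hv
      have hDv : eval v D = 0 := by
        rw [← aeval_eq_eval]
        exact hv D (Ideal.mem_span_singleton_self D)
      rw [map_mul, aeval_X]
      by_cases h0 : v = 0
      · rw [h0, Pi.zero_apply, zero_mul]
      · rw [hF _ ((mk_mem_planeCurve hr h0).mpr hDv) v h0 rfl, mul_zero]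
    rw [Ideal.mem_span_singleton]
    refine (hprime.dvd_or_dvd (Ideal.mem_span_singleton.mp (hX 0))).resolve_left ?_
    rintro ⟨G, hG⟩
    have hX0 : (D * G).IsHomogeneous 1 := hG ▸ isHomogeneous_X K 0
    obtain ⟨a, b, hab, ha, -⟩ := exists_isHomogeneous_of_mul hX0 (hG ▸ X_ne_zero 0)
    have := ha.inj_right (P_isHomogeneous hr) hprime.ne_zero
    have := eight_le_two_pow hr
    omega
  · rw [Ideal.span_singleton_le_iff_mem]
    exact fun p hp => hp

end PlaneCurve
/-! ### The component in the plane `x + z + t = 0` -/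

section SpaceCurve
variable (K : Type*) [Field K]

/-- The embedding `(x, y, z) ↦ (x, y, z, x + z)` of `K³` as the plane `x + z + t = 0`
(in characteristic two). -/
def planeEmbedding : (Fin 3 → K) →ₗ[K] (Fin 4 → K) where
  toFun v := ![v 0, v 1, v 2, v 0 + v 2]
  map_add' v w := by
    ext i; fin_cases i <;> simp [add_add_add_comm]
  map_smul' a v := by
    ext i; fin_cases i <;> simp [mul_add]

theorem planeEmbedding_injective : Function.Injective (planeEmbedding K) := by
  intro v w h
  ext i
  fin_cases i
  · exact congrFun h 0
  · exact congrFun h 1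
  · exact congrFun h 2

theorem planeEmbedding_ne_zero {v : Fin 3 → K} (hv : v ≠ 0) : planeEmbedding K v ≠ 0 :=
  (map_ne_zero_iff _ (planeEmbedding_injective K)).mpr hv

theorem planeEmbedding_comp (v : Fin 3 → K) : planeEmbedding K v ∘ ![0, 1, 2] = v := by
  ext i; fin_cases i <;> rfl

variable {K} in
theorem plane_isHomogeneous : (X 0 + X 2 + X 3 : MvPolynomial (Fin 4) K).IsHomogeneous 1 :=
  ((isHomogeneous_X K 0).add (isHomogeneous_X K 2)).add (isHomogeneous_X K 3)

variable {K} in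
theorem comp_ne_zero {v : Fin 4 → K} (hv : v ≠ 0) (h : planeEmbedding K (v ∘ ![0, 1, 2]) = v) :
    v ∘ ![0, 1, 2] ≠ 0 := by
  intro h0
  rw [h0, map_zero] at h
  exact hv h.symm

variable [CharP K 2]

/-- The part of the cone `P_{x^d}(x, y, z) = 0` in the plane `x + z + t = 0`. -/
noncomputable def planeSection (d : ℕ) : Set (PSpace K (Fin 4)) :=
  zeroLocus (X 0 + X 2 + X 3) ∩ S₁ K d

variable {K}

theorem eval_plane (v : Fin 4 → K) :
    eval v (X 0 + X 2 + X 3) = 0 ↔ planeEmbedding K (v ∘ ![0, 1, 2]) = v := by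
  simp only [map_add, eval_X]
  rw [CharTwo.add_eq_zero]
  constructor
  · intro h; ext i; fin_cases i <;> simp [planeEmbedding, h]
  · intro h; simpa [planeEmbedding] using congrFun h 3

variable [IsAlgClosed K] {r : ℕ}

theorem cone_isHomogeneous (hr : 3 ≤ r) (f : Fin 3 → Fin 4) :
    (rename f (P (Polynomial.X ^ (2 ^ r - 1) : Polynomial K))).IsHomogeneous (2 ^ r - 4) :=
  (P_isHomogeneous hr).rename_isHomogeneous

theorem mk_mem_planeSection (hr : 3 ≤ r) {v : Fin 4 → K} (hv : v ≠ 0) :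
    Projectivization.mk K v hv ∈ planeSection K (2 ^ r - 1) ↔
      planeEmbedding K (v ∘ ![0, 1, 2]) = v ∧
      eval (v ∘ ![0, 1, 2]) (P (Polynomial.X ^ (2 ^ r - 1) : Polynomial K)) = 0 := by
  rw [planeSection, Set.mem_inter_iff, mk_mem_zeroLocus plane_isHomogeneous, S₁,
    mk_mem_zeroLocus (cone_isHomogeneous hr _), eval_plane, eval_rename]

theorem mk_planeEmbedding_mem (hr : 3 ≤ r) {v : Fin 3 → K} (hv : v ≠ 0) :
    Projectivization.mk K _ (planeEmbedding_ne_zero K hv) ∈ planeSection K (2 ^ r - 1) ↔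
      Projectivization.mk K v hv ∈ planeCurve K (2 ^ r - 1) := by
  rw [mk_mem_planeSection hr, mk_mem_planeCurve hr, planeEmbedding_comp]
  simp

/-- Modulo the equation of the plane, the two cones have the same equation: this is the
invariance of the polynomial of the curve under the shear. -/
theorem plane_dvd (r : ℕ) : (X 0 + X 2 + X 3 : MvPolynomial (Fin 4) K) ∣
    rename ![0, 1, 3] (P (Polynomial.X ^ (2 ^ r - 1) : Polynomial K)) -
      rename ![0, 1, 2] (P (Polynomial.X ^ (2 ^ r - 1) : Polynomial K)) := by
  rw [← Ideal.mem_span_singleton, ← Ideal.Quotient.eq]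
  set q := Ideal.Quotient.mkₐ K (Ideal.span {(X 0 + X 2 + X 3 : MvPolynomial (Fin 4) K)})
  change q _ = q _
  conv_rhs => rw [← aeval_shear_P]
  simp only [← AlgHom.comp_apply]
  congr 1
  ext i
  fin_cases i
  · simp
  · simp
  · simp only [AlgHom.comp_apply, Fin.reduceFinMk, rename_X, aeval_X, Matrix.cons_val, map_add]
    rw [← map_add]
    refine Ideal.Quotient.eq.mpr (Ideal.mem_span_singleton.mpr ⟨1, ?_⟩)
    linear_combination (-(X 0 + X 2)) * CharTwo.two_eq_zero (R := MvPolynomial (Fin 4) K)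

theorem planeSection_subset (hr : 3 ≤ r) :
    planeSection K (2 ^ r - 1) ⊆ S₁ K (2 ^ r - 1) ∩ S₂ K (2 ^ r - 1) := by
  intro p hp
  refine ⟨hp.2, ?_⟩
  obtain ⟨Q, hQ⟩ := plane_dvd (K := K) r
  induction p using Projectivization.ind with
  | h v hv =>
    have h1 := (mk_mem_zeroLocus plane_isHomogeneous hv).mp hp.1
    have h2 := (mk_mem_zeroLocus (cone_isHomogeneous hr _) hv).mp hp.2
    refine (mk_mem_zeroLocus (cone_isHomogeneous hr _) hv).mpr ?_
    have := congrArg (eval v) hQ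
    rw [map_sub, map_mul, h1, h2, zero_mul, sub_zero] at this
    exact this

/-- Membership in the ideal of the plane section is tested on the plane curve. -/
theorem mem_idealOf_planeSection (hr : 3 ≤ r) (F : MvPolynomial (Fin 4) K) :
    F ∈ idealOf (planeSection K (2 ^ r - 1)) ↔
      aeval ![X 0, X 1, X 2, X 0 + X 2] F ∈ idealOf (planeCurve K (2 ^ r - 1)) := by
  have hcomp (v : Fin 3 → K) (F : MvPolynomial (Fin 4) K) :
      aeval v (aeval (![X 0, X 1, X 2, X 0 + X 2] : Fin 4 → MvPolynomial (Fin 3) K) F) =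
        aeval (planeEmbedding K v) F := by
    rw [← AlgHom.comp_apply]
    congr 1
    ext i
    fin_cases i <;> simp [planeEmbedding]
  constructor
  · intro h p hp v hv hvp
    subst hvp
    rw [hcomp]
    exact h _ ((mk_planeEmbedding_mem hr hv).mpr hp) _ (planeEmbedding_ne_zero K hv) rfl
  · intro h p hp v hv hvp
    subst hvp
    obtain ⟨hv', hP⟩ := (mk_mem_planeSection hr hv).mp hp
    have h0 := comp_ne_zero hv hv'
    rw [← hv', ← hcomp]
    exact h _ ((mk_mem_planeCurve hr h0).mpr hP) _ h0 rfl

/-- The quotient by the equation of the plane identifies polynomials on space with polynomials on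
the plane, where the ideal is that of the plane curve. -/
theorem idealOf_planeSection (hr : 3 ≤ r) : idealOf (planeSection K (2 ^ r - 1)) =
    Ideal.span {X 0 + X 2 + X 3,
      rename ![0, 1, 2] (P (Polynomial.X ^ (2 ^ r - 1) : Polynomial K))} := by
  set I := Ideal.span {(X 0 + X 2 + X 3 : MvPolynomial (Fin 4) K),
    rename ![0, 1, 2] (P (Polynomial.X ^ (2 ^ r - 1) : Polynomial K))} with hI
  have h1 : (X 0 + X 2 + X 3 : MvPolynomial (Fin 4) K) ∈ I := Ideal.subset_span (by simp)
  have h2 : rename ![0, 1, 2] (P (Polynomial.X ^ (2 ^ r - 1) : Polynomial K)) ∈ I :=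
    Ideal.subset_span (by simp)
  apply le_antisymm
  · intro F hF
    rw [mem_idealOf_planeSection hr, idealOf_planeCurve hr, Ideal.mem_span_singleton] at hF
    obtain ⟨G, hG⟩ := hF
    set q := Ideal.Quotient.mkₐ K I
    have hcomp : (q.comp (rename ![0, 1, 2])).comp
        (aeval ![X 0, X 1, X 2, X 0 + X 2] : MvPolynomial (Fin 4) K →ₐ[K] MvPolynomial (Fin 3) K) =
          q := by
      ext i
      fin_cases i
      · simp
      · simp
      · simp
      · simp only [AlgHom.comp_apply, Fin.reduceFinMk, rename_X, aeval_X, Matrix.cons_val, map_add]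
        rw [← map_add]
        refine Ideal.Quotient.eq.mpr ?_
        rw [CharTwo.sub_eq_add]
        exact h1
    rw [← Ideal.Quotient.eq_zero_iff_mem]
    change q F = 0
    rw [← hcomp, AlgHom.comp_apply, hG, map_mul, AlgHom.comp_apply]
    have : q (rename ![0, 1, 2] (P (Polynomial.X ^ (2 ^ r - 1) : Polynomial K))) = 0 :=
      Ideal.Quotient.eq_zero_iff_mem.mpr h2
    rw [this, zero_mul]
  · rw [hI, Ideal.span_le]
    rintro F (rfl | rfl)
    · exact fun p hp => hp.1
    · exact fun p hp => hp.2

theorem isIrreducible_planeSection (hr : 3 ≤ r) :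
    @IsIrreducible _ (zariskiTopology K (Fin 4)) (planeSection K (2 ^ r - 1)) := by
  apply isIrreducible_of_idealOf
  · obtain ⟨x, y, z, h, hne⟩ := exists_point (k := K) hr
    have h0 : ![x, y, z] ≠ 0 := by
      intro h0
      have hx : x = 0 := congrFun h0 0
      have hy : y = 0 := congrFun h0 1
      simp [hx, hy] at hne
    exact ⟨_, (mk_planeEmbedding_mem hr h0).mpr ((mk_mem_planeCurve hr h0).mpr h)⟩
  · intro F G
    simp only [mem_idealOf_planeSection hr, idealOf_planeCurve hr, Ideal.mem_span_singleton,
      map_mul]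
    exact (irreducible_P hr).prime.dvd_or_dvd

/-- The cofactor of the equation of the plane does not vanish identically on the plane section, as
otherwise the derivative of the Moore determinant by the third coordinate would vanish on the whole
plane curve. -/
theorem not_planeSection_subset_cofactor (hr : 3 ≤ r) {Q : MvPolynomial (Fin 4) K}
    (hQ : rename ![0, 1, 3] (P (Polynomial.X ^ (2 ^ r - 1) : Polynomial K)) -
      rename ![0, 1, 2] (P (Polynomial.X ^ (2 ^ r - 1) : Polynomial K)) = (X 0 + X 2 + X 3) * Q) :
    ¬ planeSection K (2 ^ r - 1) ⊆ zeroLocus Q := by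
  intro hsub
  obtain ⟨x, y, z, h, hne⟩ := exists_point (k := K) hr
  have h0 : ![x, y, z] ≠ 0 := by
    intro h0
    have hx : x = 0 := congrFun h0 0
    have hy : y = 0 := congrFun h0 1
    simp [hx, hy] at hne
  have hQ0 := hsub ((mk_planeEmbedding_mem hr h0).mpr ((mk_mem_planeCurve hr h0).mpr h)) _
    (planeEmbedding_ne_zero K h0) rfl
  -- The line through the point in the direction of the coordinate `t`.
  let l : Fin 4 → Polynomial K := 
    ![Polynomial.C x, Polynomial.C y, Polynomial.C z, Polynomial.C (x + z) + Polynomial.X]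
  have hXQ : Polynomial.X ∣ aeval l Q := by
    rw [Polynomial.X_dvd_iff, Polynomial.coeff_zero_eq_aeval_zero, comp_aeval_apply]
    convert! hQ0
    rename_i i
    fin_cases i <;> simp [l, planeEmbedding]
  have hplane : aeval l (X 0 + X 2 + X 3 : MvPolynomial (Fin 4) K) = Polynomial.X := by
    simp only [map_add, aeval_X, l, Matrix.cons_val]
    linear_combination (Polynomial.C x + Polynomial.C z) * CharTwo.two_eq_zero (R := Polynomial K)
  have hzero : aeval l (rename ![0, 1, 2] (P (Polynomial.X ^ (2 ^ r - 1) : Polynomial K))) = 0 := by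
    have : l ∘ ![0, 1, 2] = algebraMap K (Polynomial K) ∘ ![x, y, z] := by
      ext1 i; fin_cases i <;> rfl
    rw [aeval_rename, this, aeval_algebraMap_apply, aeval_eq_eval]
    simp [h]
  have hd : Polynomial.X ^ 2 ∣ aeval (l ∘ ![0, 1, 3])
      (P (Polynomial.X ^ (2 ^ r - 1) : Polynomial K)) := by
    have := congrArg (aeval l) hQ
    rw [map_sub, hzero, sub_zero, map_mul, hplane, aeval_rename] at this
    rw [this, sq]
    exact mul_dvd_mul_left _ hXQ
  have hM : Polynomial.X ^ 2 ∣ moore (2 ^ r) (l ∘ ![0, 1, 3]) := by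
    have := congrArg (aeval (l ∘ ![0, 1, 3])) (moore_mul_P (k := K) r)
    rw [map_mul, map_moore, map_moore] at this
    simp only [aeval_X] at this
    exact this ▸ dvd_mul_of_dvd_right hd _
  have hl : l ∘ ![0, 1, 3] = fun i => (fun i => Polynomial.C (![x, y, x + z] i)) i +
      Polynomial.X * (fun i => Polynomial.C (![0, 0, 1] i)) i +
        Polynomial.X ^ 2 * (fun i => Polynomial.C ((0 : Fin 3 → K) i)) i := by
    ext1 i; fin_cases i <;> simp [l]
  obtain ⟨R, hR⟩ := moore_arc (by omega : 2 ≤ r) (fun i => Polynomial.C (![x, y, x + z] i))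
    (fun i => Polynomial.C (![0, 0, 1] i)) (fun i => Polynomial.C ((0 : Fin 3 → K) i))
    (Polynomial.X : Polynomial K)
  rw [← hl] at hR
  have h1 := Polynomial.X_pow_dvd_iff.mp hM 1 (by norm_num)
  rw [hR] at h1
  simp only [det3_C] at h1
  simp only [Polynomial.coeff_add, Polynomial.coeff_X_pow_mul', Polynomial.coeff_X_mul,
    Polynomial.coeff_C_zero, Polynomial.coeff_C_succ] at h1
  apply hne
  simpa [det3] using h1

/-- An irreducible set between the plane section and the intersection of the two cones lies in
the plane or in the zero locus of the cofactor, and the latter does not contain the plane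
section. -/
theorem isComponent_planeSection (hr : 3 ≤ r) :
    IsComponent (planeSection K (2 ^ r - 1)) (S₁ K (2 ^ r - 1) ∩ S₂ K (2 ^ r - 1)) := by
  let := zariskiTopology K (Fin 4)
  refine ⟨⟨planeSection_subset hr, isIrreducible_planeSection hr⟩, fun W ⟨hW, hirr⟩ hle => ?_⟩
  obtain ⟨Q, hQ⟩ := plane_dvd (K := K) r
  have hQh : ∃ n, Q.IsHomogeneous n := by
    by_cases h0 : (X 0 + X 2 + X 3) * Q = 0
    · rw [← hQ, hQ] at h0
      have : (X 0 + X 2 + X 3 : MvPolynomial (Fin 4) K) ≠ 0 := by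
        intro h
        have := congrArg (eval ![1, 0, 0, 0]) h
        simp at this
      rw [(mul_eq_zero.mp h0).resolve_left this]
      exact ⟨0, isHomogeneous_zero _ _ _⟩
    · obtain ⟨-, b, -, -, hb⟩ := exists_isHomogeneous_of_mul
        (hQ ▸ (cone_isHomogeneous hr ![0, 1, 3]).sub (cone_isHomogeneous hr ![0, 1, 2])) h0
      exact ⟨b, hb⟩
  obtain ⟨n, hQh⟩ := hQh
  have hunion : W ⊆ zeroLocus (X 0 + X 2 + X 3) ∪ zeroLocus Q := by
    intro p hp
    rw [← zeroLocus_mul plane_isHomogeneous hQh, ← hQ]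
    intro v hv hvp
    rw [map_sub, (hW hp).1 v hv hvp, (hW hp).2 v hv hvp, sub_zero]
  rcases isPreirreducible_iff_isClosed_union_isClosed.mp hirr.2 _ _
    (isClosed_zeroLocus plane_isHomogeneous) (isClosed_zeroLocus hQh) hunion with h | h
  · exact fun p hp => ⟨h hp, (hW hp).1⟩
  · exact absurd (hle.trans h) (not_planeSection_subset_cofactor hr hQ)

theorem map_P (k : Type*) [Field k] [CharP k 2] [Algebra k K] (d : ℕ) :
    map (algebraMap k K) (P (Polynomial.X ^ d : Polynomial k)) =
      P (Polynomial.X ^ d : Polynomial K) := by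
  have h := congrArg (map (algebraMap k K)) (denom_mul_P (Polynomial.X ^ d : Polynomial k))
  have hd : map (algebraMap k K) (denom k) = denom K := by simp [denom]
  have hn : map (algebraMap k K) (numer (Polynomial.X ^ d : Polynomial k)) =
      numer (Polynomial.X ^ d : Polynomial K) := by simp [numer]
  rw [map_mul, hd, hn, ← denom_mul_P] at h
  refine mul_left_cancel₀ (fun h0 => ?_) h
  have := congrArg (moore (2 ^ 2) ![X 0, X 1, X 2] * ·) h0
  have h4 := moore_X_ne_zero (k := K) (m := 4) (by norm_num)
  rw [X_eq_vec, moore_four] at h4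
  exact right_ne_zero_of_mul h4 h0

theorem isDefinedOver_planeSection [Algebra (ZMod 2) K] (hr : 3 ≤ r) :
    IsDefinedOver (ZMod 2) (planeSection K (2 ^ r - 1)) := by
  refine ⟨?_, Ideal.span {X 0 + X 2 + X 3,
    rename ![0, 1, 2] (P (Polynomial.X ^ (2 ^ r - 1) : Polynomial (ZMod 2)))}, ?_⟩
  · let := zariskiTopology K (Fin 4)
    exact (isClosed_zeroLocus plane_isHomogeneous).inter
      (isClosed_zeroLocus (cone_isHomogeneous hr _))
  · rw [idealOf_planeSection hr, Ideal.map_span, Set.image_pair, map_rename, map_P]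
    simp only [map_add, map_X]

/-- The isomorphism is the restriction of the embedding of the plane, with the projection to
the first three coordinates as its inverse. -/
theorem isomorphicOver_planeSection (k : Type*) [Field k] [Algebra k K] (hr : 3 ≤ r) :
    IsomorphicOver k (planeSection K (2 ^ r - 1)) (planeCurve K (2 ^ r - 1)) := by
  let ι := Projectivization.map (planeEmbedding K) (planeEmbedding_injective K)
  have hι {v : Fin 3 → K} (hv : v ≠ 0) : ι (Projectivization.mk K v hv) =
      Projectivization.mk K _ (planeEmbedding_ne_zero K hv) := Projectivization.map_mk _ _ _ _
  have hmem (p : PSpace K (Fin 3)) (hp : p ∈ planeCurve K (2 ^ r - 1)) :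
      ι p ∈ planeSection K (2 ^ r - 1) := by
    induction p using Projectivization.ind with
    | h v hv => rw [hι]; exact (mk_planeEmbedding_mem hr hv).mpr hp
  let ψ (p : planeCurve K (2 ^ r - 1)) : planeSection K (2 ^ r - 1) := ⟨ι p.1, hmem p.1 p.2⟩
  have hψ : Function.Bijective ψ := by
    constructor
    · intro p q h
      exact Subtype.ext (Projectivization.map_injective _ (planeEmbedding_injective K)
        (congrArg Subtype.val h))
    · rintro ⟨p, hp⟩
      induction p using Projectivization.ind with
      | h v hv =>
        obtain ⟨hv', hP⟩ := (mk_mem_planeSection hr hv).mp hp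
        have h0 := comp_ne_zero hv hv'
        refine ⟨⟨Projectivization.mk K _ h0, (mk_mem_planeCurve hr h0).mpr hP⟩, Subtype.ext ?_⟩
        change ι (Projectivization.mk K _ h0) = _
        rw [hι]
        congr 1
  have h1 {σ : Type} (p : PSpace K σ) : ¬ VanishesAt (1 : MvPolynomial σ k) p := by
    induction p using Projectivization.ind with
    | h v hv => exact fun h => one_ne_zero ((map_one _).symm.trans (h v hv rfl))
  refine ⟨(Equiv.ofBijective ψ hψ).symm, fun p => ?_, fun p => ?_⟩
  · refine ⟨0, 1, 1, ![X 0, X 1, X 2], isHomogeneous_one _ _, h1 _, fun j => ?_,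
      fun q _ v hv hvq => ?_⟩
    · fin_cases j <;> exact isHomogeneous_X _ _
    · obtain ⟨q, rfl⟩ := (Equiv.ofBijective ψ hψ).surjective q
      obtain ⟨p, hp⟩ := q
      induction p using Projectivization.ind with
      | h w hw =>
        change _ = ι (Projectivization.mk K w hw) at hvq
        rw [hι] at hvq
        rw [Equiv.symm_apply_apply]
        obtain ⟨a, rfl⟩ :=
          (Projectivization.mk_eq_mk_iff K _ _ _ (planeEmbedding_ne_zero K hw)).mp hvq
        have hF : (fun j => aeval (a • planeEmbedding K w)
            ((![X 0, X 1, X 2] : Fin 3 → MvPolynomial (Fin 4) k) j)) = a • w := by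
          ext j; fin_cases j <;> simp [planeEmbedding, Units.smul_def]
        have haw : a • w ≠ 0 := (smul_ne_zero_iff_ne a).mpr hw
        simp only [hF]
        exact ⟨haw, (Projectivization.mk_eq_mk_iff K _ _ _ _).mpr ⟨a⁻¹, inv_smul_smul a w⟩⟩
  · refine ⟨0, 1, 1, ![X 0, X 1, X 2, X 0 + X 2], isHomogeneous_one _ _, h1 _, fun j => ?_,
      fun q _ v hv hvq => ?_⟩
    · fin_cases j
      · exact isHomogeneous_X _ _
      · exact isHomogeneous_X _ _
      · exact isHomogeneous_X _ _
      · exact (isHomogeneous_X _ _).add (isHomogeneous_X _ _)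
    · have hF : (fun j => aeval v
          ((![X 0, X 1, X 2, X 0 + X 2] : Fin 4 → MvPolynomial (Fin 3) k) j)) =
          planeEmbedding K v := by
        ext j; fin_cases j <;> simp [planeEmbedding]
      simp only [hF]
      refine ⟨planeEmbedding_ne_zero K hv, ?_⟩
      change ι q.1 = _
      rw [← hvq, hι]

end SpaceCurve
end DiffUniform

theorem mainTheorem4 (K : Type*) [Field K] [IsAlgClosed K] [CharP K 2] [Algebra (ZMod 2) K]
    (r : ℕ) (hr : 3 ≤ r) :
    (∃ C' : Set (DiffUniform.PSpace K (Fin 4)),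
      DiffUniform.IsComponent C' (DiffUniform.S₁ K (2 ^ r - 1) ∩ DiffUniform.S₂ K (2 ^ r - 1)) ∧
      DiffUniform.IsDefinedOver (ZMod 2) C' ∧
      C' ⊆ DiffUniform.zeroLocus
        (MvPolynomial.X 0 + MvPolynomial.X 2 + MvPolynomial.X 3 : MvPolynomial (Fin 4) K) ∧
      DiffUniform.IsomorphicOver (ZMod 2) C' (DiffUniform.planeCurve K (2 ^ r - 1))) ∧
    DiffUniform.idealOf (DiffUniform.planeCurve K (2 ^ r - 1)) =
      Ideal.span {DiffUniform.P (Polynomial.X ^ (2 ^ r - 1) : Polynomial K)} :=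
  ⟨⟨DiffUniform.planeSection K (2 ^ r - 1), DiffUniform.isComponent_planeSection hr,
    DiffUniform.isDefinedOver_planeSection hr, fun _ hp => hp.1,
    DiffUniform.isomorphicOver_planeSection (ZMod 2) hr⟩, DiffUniform.idealOf_planeCurve hr⟩
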